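/- **Theorem 2\* (Stieltjes case).** Let $Y\ge 0$ be a random variable with distribution $G$. Suppose that for some $a>1$ the distribution $G$ is absolutely continuous on $[a,\infty)$, i.e. $P(Y\in B)=\int_B g(x)\,dx$ for all Borel sets $B\subseteq(a,\infty)$, with a density $g$ that is continuous and strictly positive on $[a,\infty)$ and satisfies $$\int_a^\infty \frac{-\ln g(x^2)}{x^2\ln x}\,dx:=\lim_{R\to\infty}\int_a^R \frac{-\ln g(x^2)}{x^2\ln x}\,dx=\infty \tag{3}$$ and $$x\mapsto\frac{-\ln g(x)}{\ln x}\ \text{ is nondecreasing on } [a,\infty) \text{ and tends to } \infty \text{ as } x\to\infty. \tag{4}$$ Then all moments $m_k=E[Y^k]$, $k\ge1$, are finite, $Y$ satisfies Carleman's condition $\sum_{k=1}^\infty m_k^{-1/(2k)}=\infty$, and $Y$ is moment-determinate: every probability distribution on $[0,\infty)$ whose moments are all finite and equal to $m_k$ for every $k\ge1$ coincides with $G$. -/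

import Mathlib

open MeasureTheory ProbabilityTheory Set Filter Topology
open scoped ENNReal

/-- All moments of the distribution `μ` on `ℝ` are finite. -/
def HasFiniteMoments (μ : Measure ℝ) : Prop :=
  ∀ k : ℕ, Integrable (fun x : ℝ => x ^ k) μ

/-- Carleman's condition (Stieltjes case) for a distribution `μ` on `[0, ∞)`: all moments
`m_k = ∫ x ^ k dμ` are finite and `∑_{k ≥ 1} m_k ^ (-1 / (2 k)) = ∞`. The sum of nonnegative
terms is taken in `[0, ∞]`, its index is shifted by one. -/
def CarlemanStieltjes (μ : Measure ℝ) : Prop :=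
  HasFiniteMoments μ ∧
    ∑' k : ℕ, ENNReal.ofReal (∫ x, x ^ (k + 1) ∂μ) ^ (-1 / (2 * ((k : ℝ) + 1))) = ∞

/-- Moment determinacy in the Stieltjes case: `μ` has finite moments, and every probability
distribution on `[0, ∞)` with finite moments and with the same moments as `μ` equals `μ`. -/
def MDeterminateStieltjes (μ : Measure ℝ) : Prop :=
  HasFiniteMoments μ ∧
    ∀ ν : Measure ℝ, IsProbabilityMeasure ν → ν (Iio 0) = 0 → HasFiniteMoments ν →
      (∀ k : ℕ, 1 ≤ k → ∫ x, x ^ k ∂ν = ∫ x, x ^ k ∂μ) → ν = μ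

/-- `μ` is absolutely continuous on `[a, ∞)` with density `g` there, in the sense of its
distribution function: `μ (B) = ∫_B g` for all Borel sets `B ⊆ (a, ∞)`. -/
def HasDensityFrom (μ : Measure ℝ) (a : ℝ) (g : ℝ → ℝ) : Prop :=
  μ.restrict (Ioi a) = (volume.restrict (Ioi a)).withDensity (fun x => ENNReal.ofReal (g x))

/-! Write `h x = -log (g x) / log x`, so that `g x = x ^ (-h x)`. If `h b ≥ k + 2`, then by
monotonicity `g x * x ^ k ≤ x ^ (-2)` beyond `b`, and splitting at `b` gives `m_k ≤ 2 * b ^ k`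
(`HasDensityFrom.moment_le`). Taking for `b` the squares of points `y j` with `h (y j ^ 2) = K + j +
2` bounds the Carleman terms below by multiples of `1 / y j`. The integrand of the logarithmic
condition is `2 * h (x ^ 2) / x ^ 2`; estimating it between consecutive `y j` and summing by parts
shows that its divergence forces `∑ 1 / y j = ∞` (`not_summable_inv_of_log_density`).

Determinacy is then Carleman's criterion. Passing to symmetrised square roots moves the problem to
the whole line, where the difference of the two characteristic functions has all derivatives zero at
`0`, the `n`-th one being bounded by an absolute moment `M n`. Moments are log-convex, and
Carleman's inequality turns `∑ (M 0 / M n) ^ (1 / n) = ∞` into `∑ M n / M (n + 1) = ∞`, so the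
difference vanishes by `denjoy_carleman`. -/

/-! ### Carleman's inequality -/

/-- The weighted arithmetic-geometric mean step in Pólya's proof of Carleman's inequality. -/
lemma prod_rpow_le_sum_weights {a : ℕ → ℝ} (ha : ∀ k, 0 ≤ a k) (n : ℕ) :
    (∏ k ∈ Finset.range (n + 1), a k) ^ (1 / ((n : ℝ) + 1)) ≤
      (∑ k ∈ Finset.range (n + 1), (k + 2 : ℝ) ^ (k + 1) / (k + 1 : ℝ) ^ k * a k) /
        ((n + 1) * (n + 2)) := by
  -- The weights telescope: the first `n + 1` of them have product `(n + 2) ^ (n + 1)`, whose root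
  -- is the factor `n + 2` in the denominator; `n + 1` comes from the mean.
  have hprod : ∀ n : ℕ, ∏ k ∈ Finset.range n, ((k + 2 : ℝ) ^ (k + 1) / (k + 1 : ℝ) ^ k) =
      (n + 1 : ℝ) ^ n := by
    intro n
    induction n with
    | zero => simp
    | succ n ih =>
      rw [Finset.prod_range_succ, ih]
      push_cast
      field_simp
      ring
  have h := Real.geom_mean_le_arith_mean (Finset.range (n + 1)) (fun _ => 1)
    (fun k => (k + 2 : ℝ) ^ (k + 1) / (k + 1 : ℝ) ^ k * a k) (fun _ _ => zero_le_one)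
    (by simp; positivity) (fun k _ => by have := ha k; positivity)
  simp only [Real.rpow_one, Finset.sum_const, Finset.card_range, one_mul, nsmul_eq_mul,
    mul_one, Finset.prod_mul_distrib, hprod] at h
  rw [Real.mul_rpow (by positivity) (Finset.prod_nonneg fun k _ => ha k),
    Real.pow_rpow_inv_natCast (by positivity) (by positivity)] at h
  push_cast at h
  rw [le_div_iff₀ (by positivity)] at h ⊢
  rw [one_div]
  calc _ = _ := by ring
    _ ≤ _ := h

/-- **Carleman's inequality** for finite sums. -/
theorem carleman_inequality {a : ℕ → ℝ} (ha : ∀ k, 0 ≤ a k) (N : ℕ) :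
    ∑ n ∈ Finset.range N, (∏ k ∈ Finset.range (n + 1), a k) ^ (1 / ((n : ℝ) + 1)) ≤
      Real.exp 1 * ∑ k ∈ Finset.range N, a k := by
  set c : ℕ → ℝ := fun k => (k + 2 : ℝ) ^ (k + 1) / (k + 1 : ℝ) ^ k with hc
  have hc0 : ∀ k, 0 ≤ c k := fun k => by positivity
  -- Exchanging the sums, `a k` collects `∑ 1 / ((n + 1) * (n + 2))` over `k ≤ n < N`, which
  -- telescopes.
  have key : ∑ n ∈ Finset.range N, (∏ k ∈ Finset.range (n + 1), a k) ^ (1 / ((n : ℝ) + 1)) ≤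
      ∑ k ∈ Finset.range N, c k * a k * (1 / (k + 1) - 1 / (N + 1)) := by
    induction N with
    | zero => simp
    | succ N ih =>
      have hdiff : ∀ x : ℝ, x - 1 / (N + 2 : ℝ) =
          x - 1 / (N + 1 : ℝ) + 1 / ((N + 1) * (N + 2) : ℝ) := by
        intro x; field_simp; ring
      have hsplit : ∑ k ∈ Finset.range (N + 1),
            c k * a k * (1 / (k + 1) - 1 / (((N + 1 : ℕ) : ℝ) + 1)) =
          ∑ k ∈ Finset.range N, c k * a k * (1 / (k + 1) - 1 / (N + 1)) +
            (∑ k ∈ Finset.range (N + 1), c k * a k) / ((N + 1) * (N + 2)) := by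
        rw [show ((N + 1 : ℕ) : ℝ) + 1 = N + 2 by push_cast; ring]
        simp_rw [hdiff, mul_add, Finset.sum_add_distrib]
        rw [Finset.sum_range_succ (fun k => c k * a k * (1 / ((k : ℝ) + 1) - 1 / (N + 1))),
          sub_self, mul_zero, add_zero, Finset.sum_div]
        simp_rw [mul_one_div]
      rw [hsplit, Finset.sum_range_succ]
      exact add_le_add ih (prod_rpow_le_sum_weights ha N)
  refine key.trans ?_
  rw [Finset.mul_sum]
  refine Finset.sum_le_sum fun k _ => ?_
  have hck : c k * (1 / (k + 1)) ≤ Real.exp 1 := by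
    have h1 : c k * (1 / (k + 1)) = (1 / ((k : ℝ) + 1) + 1) ^ (k + 1) := by
      have : (1 / ((k : ℝ) + 1) + 1) = (k + 2) / (k + 1) := by field_simp; ring
      rw [this, div_pow, hc]
      field_simp
      ring
    rw [h1]
    calc _ ≤ Real.exp (1 / ((k : ℝ) + 1)) ^ (k + 1) :=
          pow_le_pow_left₀ (by positivity) (Real.add_one_le_exp _) _
      _ = Real.exp 1 := by
          rw [← Real.exp_nat_mul]; congr 1; push_cast; field_simp
  have h2 : c k * (1 / (k + 1) - 1 / (N + 1)) ≤ Real.exp 1 := by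
    refine le_trans (mul_le_mul_of_nonneg_left ?_ (hc0 k)) hck
    have : (0 : ℝ) ≤ 1 / (N + 1) := by positivity
    linarith
  calc _ = c k * (1 / (k + 1) - 1 / (N + 1)) * a k := by ring
    _ ≤ _ := mul_le_mul_of_nonneg_right h2 (ha k)

/-- If `∑ M n / M (n + 1)` converges, so does `∑ (M 0 / M n) ^ (1 / n)`. -/
lemma summable_rpow_of_summable_ratio {M : ℕ → ℝ} (hM : ∀ n, 0 < M n)
    (h : Summable fun n => M n / M (n + 1)) :
    Summable fun n : ℕ => (M 0 / M (n + 1)) ^ (1 / ((n : ℝ) + 1)) := by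
  have hprod : ∀ n, ∏ k ∈ Finset.range n, M k / M (k + 1) = M 0 / M n := by
    intro n
    induction n with
    | zero => simp [(hM 0).ne']
    | succ n ih =>
      rw [Finset.prod_range_succ, ih]
      have := (hM n).ne'
      field_simp
  have h0 : ∀ n, 0 ≤ M n / M (n + 1) := fun n => (div_pos (hM _) (hM _)).le
  refine summable_of_sum_range_le (c := Real.exp 1 * ∑' n, M n / M (n + 1))
    (fun n => Real.rpow_nonneg (div_pos (hM _) (hM _)).le _) fun N => ?_
  have := carleman_inequality h0 N
  simp_rw [hprod] at this
  exact this.trans (mul_le_mul_of_nonneg_left (h.sum_le_tsum _ fun n _ => h0 n)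
    (Real.exp_pos _).le)

/-! ### The Denjoy-Carleman theorem by Bang's method -/

lemma monotone_ratio_of_logConvex {M : ℕ → ℝ} (hM : ∀ n, 0 < M n)
    (hconv : ∀ n, M (n + 1) ^ 2 ≤ M n * M (n + 2)) : Monotone fun n => M (n + 1) / M n := by
  refine monotone_nat_of_le_succ fun n => ?_
  rw [div_le_div_iff₀ (hM _) (hM _)]
  nlinarith [hconv n]

/-- Bang's step: the order of vanishing drops by at most one over an interval of length
`M n / (e M (n + 1))`. -/
lemma bang_step {f : ℕ → ℝ → ℂ} {M : ℕ → ℝ} (hf : ∀ n t, HasDerivAt (f n) (f (n + 1) t) t)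
    (hM : ∀ n, 0 < M n) (hconv : ∀ n, M (n + 1) ^ 2 ≤ M n * M (n + 2))
    (hbound : ∀ n t, ‖f n t‖ ≤ M n) (n : ℕ) {t s : ℝ}
    (hs : s ∈ Icc t (t + M n / (Real.exp 1 * M (n + 1))))
    (ht : ∀ j, ‖f j t‖ ≤ Real.exp (j - (n + 1)) * M j) (j : ℕ) :
    ‖f j s‖ ≤ Real.exp (j - n) * M j := by
  set K : ℝ := Real.exp 1 * (M (n + 1) / M n) with hK
  have hK0 : 0 < K := mul_pos (Real.exp_pos _) (div_pos (hM _) (hM _))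
  -- Descending induction on the order `j`, with `i` as fuel. For `j ≥ n + 1` the global bound
  -- suffices, as both exponentials are at least `1`; for `j ≤ n` the bound on `f (j + 1)` is
  -- integrated from `t`.
  have main : ∀ i j, n + 1 ≤ i + j → ∀ x ∈ Icc t s,
      ‖f j x‖ ≤ Real.exp (j - (n + 1)) * M j * Real.exp (K * (x - t)) := by
    intro i
    induction i with
    | zero =>
      intro j hj x hx
      refine (hbound j x).trans ?_
      have hj' : ((n : ℝ) + 1) ≤ j := by exact_mod_cast (by omega : n + 1 ≤ j)
      have h1 : 1 ≤ Real.exp (j - (n + 1)) := Real.one_le_exp (by linarith)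
      have h2 : 1 ≤ Real.exp (K * (x - t)) :=
        Real.one_le_exp (mul_nonneg hK0.le (by linarith [hx.1]))
      have h3 := one_le_mul_of_one_le_of_one_le h1 h2
      nlinarith [hM j]
    | succ i ih =>
      intro j hj
      rcases le_or_gt (n + 1) (i + j) with h | h
      · exact ih j h
      have hjn : j ≤ n := by omega
      -- Log-convexity lets the single rate `K`, read off at `n`, serve every lower order.
      have hratio : Real.exp 1 * M (j + 1) ≤ K * M j := by
        have := monotone_ratio_of_logConvex hM hconv hjn
        simp only at this
        rw [div_le_iff₀ (hM j)] at this
        rw [hK, mul_assoc]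
        exact mul_le_mul_of_nonneg_left this (Real.exp_pos _).le
      refine image_norm_le_of_norm_deriv_right_le_deriv_boundary (f' := f (j + 1))
        (B' := fun x => Real.exp (j - (n + 1)) * M j * (Real.exp (K * (x - t)) * K))
        (fun x _ => (hf j x).continuousAt.continuousWithinAt)
        (fun x _ => (hf j x).hasDerivWithinAt) ?_ ?_ ?_
      · simpa using ht j
      · intro x
        have : HasDerivAt (fun x => K * (x - t)) K x := by
          simpa using ((hasDerivAt_id x).sub_const t).const_mul K
        exact this.exp.const_mul _
      · intro x hx
        refine (ih (j + 1) (by omega) x ⟨hx.1, hx.2.le⟩).trans ?_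
        have h1 : Real.exp (((j + 1 : ℕ) : ℝ) - (n + 1)) =
            Real.exp (j - (n + 1)) * Real.exp 1 := by
          rw [← Real.exp_add]; congr 1; push_cast; ring
        rw [h1]
        have h2 : 0 ≤ Real.exp ((j : ℝ) - (n + 1)) * Real.exp (K * (x - t)) := by positivity
        calc _ = Real.exp ((j : ℝ) - (n + 1)) * Real.exp (K * (x - t)) *
              (Real.exp 1 * M (j + 1)) := by ring
          _ ≤ Real.exp ((j : ℝ) - (n + 1)) * Real.exp (K * (x - t)) * (K * M j) :=
              mul_le_mul_of_nonneg_left hratio h2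
          _ = _ := by ring
  -- The interval length is chosen as `1 / K`: the growth costs one factor `e`, that is, one order.
  have hKs : K * (s - t) ≤ 1 := by
    have h1 : s - t ≤ M n / (Real.exp 1 * M (n + 1)) := by linarith [hs.2]
    calc K * (s - t) ≤ K * (M n / (Real.exp 1 * M (n + 1))) :=
          mul_le_mul_of_nonneg_left h1 hK0.le
      _ = 1 := by
          rw [hK]
          have h3 := (hM n).ne'
          have h4 := (hM (n + 1)).ne'
          field_simp
  refine (main (n + 1) j (by omega) s ⟨hs.1, le_rfl⟩).trans ?_
  calc _ ≤ Real.exp (j - (n + 1)) * M j * Real.exp 1 :=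
        mul_le_mul_of_nonneg_left (Real.exp_le_exp.2 hKs)
          (mul_nonneg (Real.exp_pos _).le (hM j).le)
    _ = Real.exp (j - (n + 1) + 1) * M j := by rw [Real.exp_add]; ring
    _ = _ := by congr 2; ring

/-- **Denjoy-Carleman theorem** (one-sided): if the derivatives `f n` of `f 0` are bounded by a
log-convex sequence `M` with `∑ M n / M (n + 1) = ∞` and all vanish at `0`, then `f 0`
vanishes on `[0, ∞)`. -/
theorem denjoy_carleman {f : ℕ → ℝ → ℂ} {M : ℕ → ℝ}
    (hf : ∀ n t, HasDerivAt (f n) (f (n + 1) t) t) (hM : ∀ n, 0 < M n)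
    (hconv : ∀ n, M (n + 1) ^ 2 ≤ M n * M (n + 2)) (hbound : ∀ n t, ‖f n t‖ ≤ M n)
    (hzero : ∀ n, f n 0 = 0) (hdiv : ¬ Summable fun n => M n / M (n + 1)) {t : ℝ}
    (ht : 0 ≤ t) : f 0 t = 0 := by
  set d : ℕ → ℝ := fun n => M n / (Real.exp 1 * M (n + 1)) with hd
  have hd0 : ∀ n, 0 < d n := fun n => div_pos (hM _) (mul_pos (Real.exp_pos _) (hM _))
  -- Going from `0` to `s` in steps of lengths at most `d (n + k - 1), ..., d n` leaves order `n`,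
  -- since at `0` every order is available.
  have chain : ∀ k n s, 0 ≤ s → s ≤ ∑ i ∈ Finset.range k, d (n + i) →
      ∀ j, ‖f j s‖ ≤ Real.exp (j - n) * M j := by
    intro k
    induction k with
    | zero =>
      intro n s h0 h1 j
      have : s = 0 := le_antisymm (by simpa using h1) h0
      rw [this, hzero, norm_zero]
      exact mul_nonneg (Real.exp_pos _).le (hM j).le
    | succ k ih =>
      intro n s h0 h1
      rw [Finset.sum_range_succ'] at h1
      have h2 : s - d n ≤ ∑ i ∈ Finset.range k, d (n + 1 + i) := by
        have : ∀ i, n + 1 + i = n + (i + 1) := fun i => by ring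
        simp_rw [this]
        simp only [add_zero] at h1
        linarith
      have h3 : ∀ j, ‖f j (max 0 (s - d n))‖ ≤ Real.exp (j - (n + 1)) * M j := by
        have := ih (n + 1) (max 0 (s - d n)) (le_max_left _ _)
          (max_le (Finset.sum_nonneg fun i _ => (hd0 _).le) h2)
        push_cast at this
        exact this
      refine bang_step hf hM hconv hbound n ⟨max_le h0 (by linarith [hd0 n]), ?_⟩ h3
      have := le_max_right 0 (s - d n)
      change s ≤ _ + d n
      linarith
  have hdd : ¬ Summable d := by
    intro h
    refine hdiv ((h.mul_left (Real.exp 1)).congr fun n => ?_)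
    have := (hM (n + 1)).ne'
    rw [hd]
    field_simp
  -- Every tail of `∑ d` diverges, so `t` is reached by a chain that ends at an arbitrarily large
  -- order `n`.
  have hle : ∀ n : ℕ, ‖f 0 t‖ ≤ Real.exp (-n) * M 0 := by
    intro n
    have hn : ¬ Summable fun i => d (n + i) := by
      simp_rw [add_comm n]
      rwa [summable_nat_add_iff]
    have htop := (not_summable_iff_tendsto_nat_atTop_of_nonneg (fun i => (hd0 (n + i)).le)).1 hn
    obtain ⟨k, hk⟩ := (htop.eventually_ge_atTop t).exists
    simpa using chain k n t ht hk 0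
  have hlim : Tendsto (fun n : ℕ => Real.exp (-n) * M 0) atTop (𝓝 0) := by
    simpa using ((Real.tendsto_exp_neg_atTop_nhds_zero.comp
      tendsto_natCast_atTop_atTop).mul_const (M 0))
  exact norm_le_zero_iff.1 (ge_of_tendsto' hlim hle)

/-! ### Carleman's criterion on the real line -/

lemma HasFiniteMoments.add {μ ν : Measure ℝ} (hμ : HasFiniteMoments μ)
    (hν : HasFiniteMoments ν) : HasFiniteMoments (μ + ν) :=
  fun k => (hμ k).add_measure (hν k)

lemma HasFiniteMoments.integrable_abs_pow {μ : Measure ℝ} (hμ : HasFiniteMoments μ) (k : ℕ) :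
    Integrable (fun x => |x| ^ k) μ := by
  simpa [abs_pow] using (hμ k).abs

lemma HasFiniteMoments.memLp_id {μ : Measure ℝ} (hμ : HasFiniteMoments μ) [IsFiniteMeasure μ]
    (n : ℕ) : MemLp id n μ := by
  rcases Nat.eq_zero_or_pos n with rfl | hn
  · simpa using aestronglyMeasurable_id
  · rw [← integrable_norm_rpow_iff aestronglyMeasurable_id (by exact_mod_cast hn.ne') (by simp)]
    simpa using hμ.integrable_abs_pow n

/-- Absolute moments form a log-convex sequence. -/
lemma absMoment_logConvex {μ : Measure ℝ} (hμ : HasFiniteMoments μ) {n : ℕ}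
    (hpos : 0 < ∫ x, |x| ^ n ∂μ) :
    (∫ x, |x| ^ (n + 1) ∂μ) ^ 2 ≤ (∫ x, |x| ^ n ∂μ) * ∫ x, |x| ^ (n + 2) ∂μ := by
  set A := ∫ x, |x| ^ n ∂μ
  set B := ∫ x, |x| ^ (n + 1) ∂μ
  have h0 : 0 ≤ ∫ x, (A ^ 2 * |x| ^ (n + 2) - 2 * A * B * |x| ^ (n + 1) + B ^ 2 * |x| ^ n) ∂μ := by
    refine integral_nonneg fun x => ?_
    have : A ^ 2 * |x| ^ (n + 2) - 2 * A * B * |x| ^ (n + 1) + B ^ 2 * |x| ^ n =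
        |x| ^ n * (A * |x| - B) ^ 2 := by ring
    simp only [Pi.zero_apply]
    rw [this]
    positivity
  have i := hμ.integrable_abs_pow
  have i₁ : Integrable (fun x => A ^ 2 * |x| ^ (n + 2) - 2 * A * B * |x| ^ (n + 1)) μ :=
    ((i _).const_mul _).sub ((i _).const_mul _)
  rw [integral_add i₁ ((i _).const_mul _), integral_sub ((i _).const_mul _) ((i _).const_mul _)] at h0
  simp only [integral_const_mul] at h0
  have h1 : 0 ≤ A * (A * (∫ x, |x| ^ (n + 2) ∂μ) - B ^ 2) := by
    calc _ ≤ _ := h0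
      _ = _ := by ring
  have := nonneg_of_mul_nonneg_right h1 hpos
  linarith

lemma HasFiniteMoments.contDiff_charFun {μ : Measure ℝ} (hμ : HasFiniteMoments μ)
    [IsFiniteMeasure μ] (n : ℕ) : ContDiff ℝ n (charFun μ) :=
  MeasureTheory.contDiff_charFun (hμ.memLp_id n)

lemma HasFiniteMoments.hasDerivAt_iteratedDeriv_charFun {μ : Measure ℝ}
    (hμ : HasFiniteMoments μ) [IsFiniteMeasure μ] (n : ℕ) (t : ℝ) :
    HasDerivAt (iteratedDeriv n (charFun μ)) (iteratedDeriv (n + 1) (charFun μ) t) t := by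
  rw [iteratedDeriv_succ]
  exact ((hμ.contDiff_charFun (n + 1)).differentiable_iteratedDeriv n
    (by exact_mod_cast n.lt_succ_self)).differentiableAt.hasDerivAt

lemma HasFiniteMoments.norm_iteratedDeriv_charFun_le {μ : Measure ℝ}
    (hμ : HasFiniteMoments μ) [IsFiniteMeasure μ] (n : ℕ) (t : ℝ) :
    ‖iteratedDeriv n (charFun μ) t‖ ≤ ∫ x, |x| ^ n ∂μ := by
  rw [iteratedDeriv_charFun (hμ.memLp_id n), norm_mul, norm_pow, Complex.norm_I, one_pow, one_mul]
  refine (norm_integral_le_integral_norm _).trans_eq (integral_congr_ae (ae_of_all _ fun x => ?_))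
  have : (t * x * Complex.I : ℂ) = ((t * x : ℝ) : ℂ) * Complex.I := by push_cast; ring
  simp only [norm_mul, norm_pow, this, Complex.norm_exp_ofReal_mul_I, Complex.norm_real, mul_one,
    Real.norm_eq_abs]

/-- **Carleman's criterion** on the real line: two finite measures with the same moments
coincide if `∑ (M 0 / M n) ^ (1 / n) = ∞` for the absolute moments `M n` of their sum. -/
theorem eq_of_moments_eq_of_carleman {μ ν : Measure ℝ} [IsFiniteMeasure μ] [IsFiniteMeasure ν]
    (hμ : HasFiniteMoments μ) (hν : HasFiniteMoments ν)
    (heq : ∀ k : ℕ, ∫ x, x ^ k ∂μ = ∫ x, x ^ k ∂ν)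
    (hpos : ∀ n : ℕ, 0 < ∫ x, |x| ^ n ∂(μ + ν))
    (hdiv : ¬ Summable fun n : ℕ =>
      ((∫ x, |x| ^ 0 ∂(μ + ν)) / ∫ x, |x| ^ (n + 1) ∂(μ + ν)) ^ (1 / ((n : ℝ) + 1))) :
    μ = ν := by
  have hratio := mt (summable_rpow_of_summable_ratio (M := fun n => ∫ x, |x| ^ n ∂(μ + ν)) hpos)
    hdiv
  have hbound : ∀ n t, ‖iteratedDeriv n (charFun μ) t - iteratedDeriv n (charFun ν) t‖ ≤
      ∫ x, |x| ^ n ∂(μ + ν) := by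
    intro n t
    rw [integral_add_measure (hμ.integrable_abs_pow n) (hν.integrable_abs_pow n)]
    exact (norm_sub_le _ _).trans (add_le_add (hμ.norm_iteratedDeriv_charFun_le n t)
      (hν.norm_iteratedDeriv_charFun_le n t))
  have hnonneg : ∀ t : ℝ, 0 ≤ t → charFun μ t = charFun ν t := by
    intro t ht
    have := denjoy_carleman
      (f := fun n t => iteratedDeriv n (charFun μ) t - iteratedDeriv n (charFun ν) t)
      (fun n t => (hμ.hasDerivAt_iteratedDeriv_charFun n t).sub
        (hν.hasDerivAt_iteratedDeriv_charFun n t)) hpos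
      (fun n => absMoment_logConvex (hμ.add hν) (hpos n)) hbound
      (fun n => by
        rw [iteratedDeriv_charFun_zero (hμ.memLp_id n), iteratedDeriv_charFun_zero (hν.memLp_id n),
          heq, sub_self]) hratio ht
    simpa [sub_eq_zero] using this
  refine Measure.ext_of_charFun (funext fun t => ?_)
  rcases le_total 0 t with ht | ht
  · exact hnonneg t ht
  · have := hnonneg (-t) (by linarith)
    rw [charFun_neg, charFun_neg] at this
    exact (starRingEnd ℂ).injective this

/-! ### Carleman's criterion on the half-line -/

/-- The symmetrised square root of a distribution on `[0, ∞)`, of total mass twice the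
original one. -/
noncomputable def symmSqrt (μ : Measure ℝ) : Measure ℝ :=
  μ.map Real.sqrt + μ.map (fun x => -Real.sqrt x)

instance (μ : Measure ℝ) [IsFiniteMeasure μ] : IsFiniteMeasure (symmSqrt μ) := by
  unfold symmSqrt; infer_instance

lemma measurable_neg_sqrt : Measurable fun x : ℝ => -√x := Real.continuous_sqrt.measurable.neg

lemma HasFiniteMoments.integrable_sqrt_pow {μ : Measure ℝ} (hμ : HasFiniteMoments μ) (k : ℕ) :
    Integrable (fun x => √x ^ k) μ := by
  refine ((hμ 0).norm.add (hμ.integrable_abs_pow k)).mono'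
    (Real.continuous_sqrt.pow k).aestronglyMeasurable (ae_of_all _ fun x => ?_)
  have h0 := Real.sqrt_nonneg x
  simp only [pow_zero, norm_one, Pi.add_apply, Real.norm_eq_abs, abs_of_nonneg (pow_nonneg h0 k)]
  have hx : 0 ≤ |x| ^ k := by positivity
  rcases le_total |x| 1 with h | h
  · have : √x ^ k ≤ 1 := pow_le_one₀ h0 (Real.sqrt_le_one.2 ((le_abs_self x).trans h))
    linarith
  · have : √x ≤ |x| := by
      rw [Real.sqrt_le_left (abs_nonneg x)]
      nlinarith [le_abs_self x]
    have := pow_le_pow_left₀ h0 this k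
    linarith

lemma HasFiniteMoments.symmSqrt {μ : Measure ℝ} (hμ : HasFiniteMoments μ) :
    HasFiniteMoments (symmSqrt μ) := by
  intro k
  refine Integrable.add_measure ?_ ?_
  · rw [integrable_map_measure (by fun_prop) Real.continuous_sqrt.aemeasurable]
    exact hμ.integrable_sqrt_pow k
  · rw [integrable_map_measure (by fun_prop) measurable_neg_sqrt.aemeasurable]
    simpa [Function.comp_def, ← mul_pow] using (hμ.integrable_sqrt_pow k).const_mul ((-1) ^ k)

/-- Odd moments cancel, so for `μ` on the half-line the moments of `symmSqrt μ` depend only on the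
integer moments of `μ`, not on the half-integer ones. -/
lemma integral_pow_symmSqrt {μ : Measure ℝ} (hμ : HasFiniteMoments μ) (k : ℕ) :
    ∫ x, x ^ k ∂symmSqrt μ = (1 + (-1) ^ k) * ∫ x, √x ^ k ∂μ := by
  have h := hμ.symmSqrt k
  rw [symmSqrt, integrable_add_measure] at h
  rw [symmSqrt, integral_add_measure h.1 h.2,
    integral_map Real.continuous_sqrt.aemeasurable (by fun_prop),
    integral_map measurable_neg_sqrt.aemeasurable (by fun_prop), add_mul, one_mul,
    ← integral_const_mul]
  simp_rw [← mul_pow, neg_one_mul]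

lemma integral_abs_pow_symmSqrt {μ : Measure ℝ} (hμ : HasFiniteMoments μ) (k : ℕ) :
    ∫ x, |x| ^ k ∂symmSqrt μ = 2 * ∫ x, √x ^ k ∂μ := by
  have h := hμ.symmSqrt.integrable_abs_pow k
  rw [symmSqrt, integrable_add_measure] at h
  rw [symmSqrt, integral_add_measure h.1 h.2,
    integral_map Real.continuous_sqrt.aemeasurable (by fun_prop),
    integral_map measurable_neg_sqrt.aemeasurable (by fun_prop)]
  simp only [abs_neg, abs_of_nonneg (Real.sqrt_nonneg _)]
  ring

lemma ae_nonneg_of_measure_Iio {μ : Measure ℝ} (h : μ (Iio 0) = 0) : ∀ᵐ x ∂μ, 0 ≤ x := by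
  rw [ae_iff]
  simp only [not_le]
  exact h

lemma integral_sqrt_pow_even {μ : Measure ℝ} (h : μ (Iio 0) = 0) (k : ℕ) :
    ∫ x, √x ^ (2 * k) ∂μ = ∫ x, x ^ k ∂μ := by
  refine integral_congr_ae ((ae_nonneg_of_measure_Iio h).mono fun x hx => ?_)
  simp only [pow_mul, Real.sq_sqrt hx]

/-- Squaring undoes both branches of the root, so `symmSqrt` loses no information on the half-line.
-/
lemma map_sq_symmSqrt {μ : Measure ℝ} (h : μ (Iio 0) = 0) :
    (symmSqrt μ).map (fun x => x ^ 2) = 2 • μ := by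
  have hsq : Measurable fun x : ℝ => x ^ 2 := by fun_prop
  have hid : ∀ φ : ℝ → ℝ, (∀ x, 0 ≤ x → φ x = x) → μ.map φ = μ := fun φ hφ =>
    (Measure.map_congr ((ae_nonneg_of_measure_Iio h).mono fun x hx => hφ x hx)).trans
      Measure.map_id
  rw [symmSqrt, Measure.map_add _ _ hsq, Measure.map_map hsq Real.continuous_sqrt.measurable,
    Measure.map_map hsq measurable_neg_sqrt, hid _ fun x hx => ?_, hid _ fun x hx => ?_, two_smul]
  · simp [Real.sq_sqrt hx]
  · simp [Real.sq_sqrt hx]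

/-- **Carleman's criterion** on the half-line: a probability distribution on `[0, ∞)`, not
concentrated at `0`, which satisfies Carleman's condition is moment-determinate. -/
theorem CarlemanStieltjes.mDeterminateStieltjes {μ : Measure ℝ} [IsProbabilityMeasure μ]
    (hneg : μ (Iio 0) = 0) (hpos : μ (Ioi 0) ≠ 0) (hC : CarlemanStieltjes μ) :
    MDeterminateStieltjes μ := by
  obtain ⟨hμ, hsum⟩ := hC
  refine ⟨hμ, fun ν _ hνneg hν hmom => ?_⟩
  have hmom' : ∀ k : ℕ, ∫ x, x ^ k ∂ν = ∫ x, x ^ k ∂μ := by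
    intro k
    rcases Nat.eq_zero_or_pos k with rfl | hk
    · simp
    · exact hmom k hk
  set M : ℕ → ℝ := fun n => ∫ x, |x| ^ n ∂(symmSqrt ν + symmSqrt μ) with hM
  have hMn : ∀ n, M n = 2 * (∫ x, √x ^ n ∂ν) + 2 * ∫ x, √x ^ n ∂μ := by
    intro n
    rw [hM, ← integral_abs_pow_symmSqrt hν, ← integral_abs_pow_symmSqrt hμ]
    exact integral_add_measure (hν.symmSqrt.integrable_abs_pow n)
      (hμ.symmSqrt.integrable_abs_pow n)
  have hMeven : ∀ k, M (2 * k) = 4 * ∫ x, x ^ k ∂μ := by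
    intro k
    rw [hMn, integral_sqrt_pow_even hνneg, integral_sqrt_pow_even hneg, hmom']
    ring
  have hMpos : ∀ n, 0 < M n := by
    intro n
    have h1 : 0 ≤ ∫ x, √x ^ n ∂ν := integral_nonneg fun x => by positivity
    have h2 : 0 < ∫ x, √x ^ n ∂μ := by
      rw [integral_pos_iff_support_of_nonneg (fun x => by positivity) (hμ.integrable_sqrt_pow n)]
      refine (pos_iff_ne_zero.2 hpos).trans_le (measure_mono fun x hx => ?_)
      exact (pow_pos (Real.sqrt_pos.2 hx) n).ne'
    rw [hMn]
    linarith
  have hdiv : ¬ Summable fun n : ℕ => (M 0 / M (n + 1)) ^ (1 / ((n : ℝ) + 1)) := by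
    intro hs
    -- Only the even `M n` are known from the moments of `μ`; this subseries is exactly the Carleman
    -- series, the factors `4` cancelling.
    have hinj : Function.Injective fun k : ℕ => 2 * k + 1 := fun i j hij => by
      simpa using hij
    refine (hs.comp_injective hinj).tsum_ofReal_ne_top ?_
    rw [← hsum]
    refine tsum_congr fun k => ?_
    have hk : 0 < ∫ x, x ^ (k + 1) ∂μ := by
      have := hMpos (2 * (k + 1))
      rw [hMeven] at this
      linarith
    have h0 : M 0 = 4 := by
      have := hMeven 0
      simpa using this
    have h2 : M (2 * k + 1 + 1) = 4 * ∫ x, x ^ (k + 1) ∂μ := hMeven (k + 1)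
    rw [ENNReal.ofReal_rpow_of_pos hk]
    congr 1
    simp only [Function.comp_apply]
    rw [h0, h2, neg_div, Real.rpow_neg hk.le, ← Real.inv_rpow hk.le]
    congr 1
    · field_simp
    · push_cast
      congr 1
      ring
  have hsymm : symmSqrt ν = symmSqrt μ := by
    refine eq_of_moments_eq_of_carleman hν.symmSqrt hμ.symmSqrt (fun k => ?_) hMpos hdiv
    rw [integral_pow_symmSqrt hν, integral_pow_symmSqrt hμ]
    rcases Nat.even_or_odd' k with ⟨j, rfl | rfl⟩
    · rw [integral_sqrt_pow_even hνneg, integral_sqrt_pow_even hneg, hmom']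
    · simp [pow_succ, pow_mul]
  have h2 : 2 • ν = 2 • μ := by
    rw [← map_sq_symmSqrt hνneg, ← map_sq_symmSqrt hneg, hsymm]
  ext s _
  have h3 : (2 • ν) s = (2 • μ) s := by rw [h2]
  simp only [Measure.smul_apply, nsmul_eq_mul] at h3
  exact (ENNReal.mul_right_inj (by simp) (by simp)).1 h3

/-! ### Carleman's condition from the density -/

section Density

variable {G : Measure ℝ} {a : ℝ} {g : ℝ → ℝ}

lemma HasDensityFrom.restrict_Ioi (hdens : HasDensityFrom G a g) {b : ℝ} (hab : a ≤ b) :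
    G.restrict (Ioi b) =
      (volume.restrict (Ioi b)).withDensity (fun x => ENNReal.ofReal (g x)) := by
  have h := congrArg (fun μ : Measure ℝ => μ.restrict (Ioi b)) hdens
  simp only [restrict_withDensity measurableSet_Ioi,
    Measure.restrict_restrict measurableSet_Ioi, Ioi_inter_Ioi, sup_eq_left.2 hab] at h
  exact h

lemma aemeasurable_density (hcont : ContinuousOn g (Ici a)) {b : ℝ} (hab : a ≤ b) :
    AEMeasurable (fun x => ENNReal.ofReal (g x)) (volume.restrict (Ioi b)) :=
  ((hcont.mono fun _ hx => hab.trans (mem_Ioi.1 hx).le).aemeasurable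
    measurableSet_Ioi).ennreal_ofReal

lemma HasDensityFrom.measure_Ioi_ne_zero (hdens : HasDensityFrom G a g)
    (hcont : ContinuousOn g (Ici a)) (hpos : ∀ x ∈ Ici a, 0 < g x) : G (Ioi a) ≠ 0 := by
  intro h0
  rw [← Measure.restrict_eq_zero, hdens.restrict_Ioi le_rfl,
    withDensity_eq_zero_iff (aemeasurable_density hcont le_rfl)] at h0
  have h1 : ∀ᵐ x ∂volume.restrict (Ioi a), False := by
    filter_upwards [h0, ae_restrict_mem measurableSet_Ioi] with x hx hxa
    have := hpos x (mem_Ioi.1 hxa).le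
    simp only [Pi.zero_apply, ENNReal.ofReal_eq_zero] at hx
    linarith
  rw [eventually_false_iff_eq_bot, ae_eq_bot, Measure.restrict_eq_zero, Real.volume_Ioi] at h1
  exact ENNReal.top_ne_zero h1

/-- The hypothesis says `g x ≤ x ^ (-(k + 2))`; the extra `2` makes the tail integrable. -/
lemma density_mul_pow_le (ha : 1 < a) (hpos : ∀ x ∈ Ici a, 0 < g x) {x : ℝ} (hx : a ≤ x) {k : ℕ}
    (hk : (k : ℝ) + 2 ≤ -Real.log (g x) / Real.log x) : g x * x ^ k ≤ x ^ (-2 : ℝ) := by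
  have hx1 : 1 < x := ha.trans_le hx
  have hx0 : 0 < x := by linarith
  have hg := hpos x hx
  rw [le_div_iff₀ (Real.log_pos hx1)] at hk
  rw [← Real.log_le_log_iff (by positivity) (by positivity), Real.log_rpow hx0,
    Real.log_mul hg.ne' (by positivity), Real.log_pow]
  linarith

lemma HasDensityFrom.lintegral_pow_Ioi_le (hdens : HasDensityFrom G a g) (ha : 1 < a)
    (hcont : ContinuousOn g (Ici a)) (hpos : ∀ x ∈ Ici a, 0 < g x)
    (hmono : MonotoneOn (fun x : ℝ => -Real.log (g x) / Real.log x) (Ici a)) {b : ℝ} (hab : a ≤ b)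
    {k : ℕ} (hk : (k : ℝ) + 2 ≤ -Real.log (g b) / Real.log b) :
    ∫⁻ x in Ioi b, ENNReal.ofReal (x ^ k) ∂G ≤ 1 := by
  have hb1 : 1 < b := ha.trans_le hab
  rw [hdens.restrict_Ioi hab,
    lintegral_withDensity_eq_lintegral_mul₀ (aemeasurable_density hcont hab) (by fun_prop)]
  calc _ ≤ ∫⁻ x in Ioi b, ENNReal.ofReal (x ^ (-2 : ℝ)) := by
        refine setLIntegral_mono' measurableSet_Ioi fun x hx => ?_
        have hax : a ≤ x := hab.trans (mem_Ioi.1 hx).le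
        simp only [Pi.mul_apply]
        rw [← ENNReal.ofReal_mul (hpos x hax).le]
        exact ENNReal.ofReal_le_ofReal
          (density_mul_pow_le ha hpos hax (hk.trans (hmono hab hax (mem_Ioi.1 hx).le)))
    _ = ENNReal.ofReal (∫ x in Ioi b, x ^ (-2 : ℝ)) := by
        rw [ofReal_integral_eq_lintegral_ofReal
          (integrableOn_Ioi_rpow_of_lt (by norm_num) (by linarith))]
        filter_upwards [ae_restrict_mem measurableSet_Ioi] with x hx
        exact Real.rpow_nonneg (by linarith [mem_Ioi.1 hx]) _
    _ ≤ 1 := by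
        rw [integral_Ioi_rpow_of_lt (by norm_num) (by linarith), ENNReal.ofReal_le_one,
          show (-2 + 1 : ℝ) = -1 by norm_num, neg_div_neg_eq, div_one]
        exact Real.rpow_le_one_of_one_le_of_nonpos hb1.le (by norm_num)

/-- The mass up to `b` contributes at most `b ^ k`, the tail at most `1 ≤ b ^ k`. -/
lemma HasDensityFrom.moment_le [IsProbabilityMeasure G] (hneg : G (Iio 0) = 0)
    (hdens : HasDensityFrom G a g) (ha : 1 < a)
    (hcont : ContinuousOn g (Ici a)) (hpos : ∀ x ∈ Ici a, 0 < g x)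
    (hmono : MonotoneOn (fun x : ℝ => -Real.log (g x) / Real.log x) (Ici a)) {b : ℝ} (hab : a ≤ b)
    {k : ℕ} (hk : (k : ℝ) + 2 ≤ -Real.log (g b) / Real.log b) :
    Integrable (fun x : ℝ => x ^ k) G ∧ ∫ x, x ^ k ∂G ≤ 2 * b ^ k := by
  have hb1 : 1 < b := ha.trans_le hab
  have hnn : ∀ᵐ x ∂G, 0 ≤ x ^ k := (ae_nonneg_of_measure_Iio hneg).mono fun x hx => pow_nonneg hx k
  have hle : ∫⁻ x, ENNReal.ofReal (x ^ k) ∂G ≤ ENNReal.ofReal (2 * b ^ k) := by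
    rw [← lintegral_add_compl _ (measurableSet_Ioi (a := b)), compl_Ioi, two_mul, add_comm,
      ENNReal.ofReal_add (by positivity) (by positivity)]
    refine add_le_add ?_ ?_
    · calc _ ≤ ∫⁻ _ in Iic b, ENNReal.ofReal (b ^ k) ∂G := by
            refine lintegral_mono_ae ?_
            filter_upwards [ae_restrict_mem measurableSet_Iic,
              ae_restrict_of_ae (ae_nonneg_of_measure_Iio hneg)] with x hx hx0
            exact ENNReal.ofReal_le_ofReal (pow_le_pow_left₀ hx0 hx k)
        _ ≤ _ := by
            rw [setLIntegral_const]
            exact mul_le_of_le_one_right' prob_le_one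
    · refine (hdens.lintegral_pow_Ioi_le ha hcont hpos hmono hab hk).trans ?_
      rw [ENNReal.one_le_ofReal]
      exact one_le_pow₀ hb1.le
  have hint : Integrable (fun x : ℝ => x ^ k) G := by
    refine ⟨by fun_prop, ?_⟩
    rw [hasFiniteIntegral_iff_ofReal hnn]
    exact hle.trans_lt ENNReal.ofReal_lt_top
  refine ⟨hint, ?_⟩
  rw [← ofReal_integral_eq_lintegral_ofReal hint hnn] at hle
  exact (ENNReal.ofReal_le_ofReal_iff (by positivity)).1 hle

lemma HasDensityFrom.hasFiniteMoments [IsProbabilityMeasure G] (hneg : G (Iio 0) = 0)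
    (hdens : HasDensityFrom G a g) (ha : 1 < a)
    (hcont : ContinuousOn g (Ici a)) (hpos : ∀ x ∈ Ici a, 0 < g x)
    (hmono : MonotoneOn (fun x : ℝ => -Real.log (g x) / Real.log x) (Ici a))
    (hlim : Tendsto (fun x : ℝ => -Real.log (g x) / Real.log x) atTop atTop) :
    HasFiniteMoments G := by
  intro k
  obtain ⟨b, hb, hab⟩ :=
    ((hlim.eventually_ge_atTop ((k : ℝ) + 2)).and (eventually_ge_atTop a)).exists
  exact (hdens.moment_le hneg ha hcont hpos hmono hab hb).1

/-- On an interval whose image under squaring has `-log g x / log x ≤ C`, the integral in the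
logarithmic condition is at most `2 C` times the increment of `-1 / x`. -/
lemma integral_log_density_le (ha : 1 < a) (hcont : ContinuousOn g (Ici a))
    (hpos : ∀ x ∈ Ici a, 0 < g x)
    (hmono : MonotoneOn (fun x : ℝ => -Real.log (g x) / Real.log x) (Ici a)) {u v C : ℝ}
    (hau : a ≤ u) (huv : u ≤ v) (hC : -Real.log (g (v ^ 2)) / Real.log (v ^ 2) ≤ C) :
    IntervalIntegrable (fun x => -Real.log (g (x ^ 2)) / (x ^ 2 * Real.log x)) volume u v ∧
    ∫ x in u..v, -Real.log (g (x ^ 2)) / (x ^ 2 * Real.log x) ≤ 2 * (C * (u⁻¹ - v⁻¹)) := by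
  have hsq : ∀ x, u ≤ x → a ≤ x ^ 2 := fun x hx => by nlinarith
  have hint : IntervalIntegrable (fun x => -Real.log (g (x ^ 2)) / (x ^ 2 * Real.log x))
      volume u v := by
    refine ContinuousOn.intervalIntegrable_of_Icc huv ?_
    have h1 : ContinuousOn (fun x : ℝ => g (x ^ 2)) (Icc u v) :=
      hcont.comp (by fun_prop) fun x hx => hsq x hx.1
    have h2 : ContinuousOn Real.log (Icc u v) :=
      Real.continuousOn_log.mono fun x hx => by
        have := hx.1
        simp only [mem_compl_iff, mem_singleton_iff]
        linarith
    refine ((h1.log fun x hx => (hpos _ (hsq x hx.1)).ne').neg).div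
      (((continuous_pow 2).continuousOn).mul h2) fun x hx => ?_
    have hx1 : 1 < x := by linarith [hx.1]
    have := Real.log_pos hx1
    positivity
  refine ⟨hint, ?_⟩
  have hderiv : ∀ x ∈ uIcc u v, HasDerivAt (fun x : ℝ => -(2 * C * x⁻¹)) (2 * C * (x ^ 2)⁻¹) x := by
    intro x hx
    rw [uIcc_of_le huv] at hx
    have hx0 : x ≠ 0 := by linarith [hx.1]
    exact ((hasDerivAt_inv hx0).const_mul (2 * C)).neg.congr_deriv (by ring)
  have hint' : IntervalIntegrable (fun x : ℝ => 2 * C * (x ^ 2)⁻¹) volume u v := by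
    refine ContinuousOn.intervalIntegrable_of_Icc huv ?_
    refine continuousOn_const.mul ((continuous_pow 2).continuousOn.inv₀ fun x hx => ?_)
    have : 0 < x := by linarith [hx.1]
    positivity
  calc _ ≤ ∫ x in u..v, 2 * C * (x ^ 2)⁻¹ := by
        refine intervalIntegral.integral_mono_on huv hint hint' fun x hx => ?_
        have hx1 : 1 < x := by linarith [hx.1]
        have hlog := Real.log_pos hx1
        have hm := (hmono (hsq x hx.1) (hsq v huv)
          (pow_le_pow_left₀ (by linarith) hx.2 2)).trans hC
        -- The factor `2` of the bound is that of `log (x ^ 2) = 2 * log x`.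
        simp only [Real.log_pow] at hm
        calc _ = 2 * (-Real.log (g (x ^ 2)) / ((2 : ℕ) * Real.log x)) * (x ^ 2)⁻¹ := by
              push_cast; field_simp
          _ ≤ _ := by gcongr
    _ = _ := by
        rw [intervalIntegral.integral_eq_sub_of_hasDerivAt hderiv hint']
        ring

/-- The logarithmic condition forces `∑ 1 / y k = ∞` for the points `y k` at which
`-log g (x ^ 2) / log (x ^ 2)` takes the value `K + k + 2`. -/
lemma not_summable_inv_of_log_density (ha : 1 < a) (hcont : ContinuousOn g (Ici a))
    (hpos : ∀ x ∈ Ici a, 0 < g x)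
    (hK : Tendsto (fun R : ℝ => ∫ x in a..R, -Real.log (g (x ^ 2)) / (x ^ 2 * Real.log x))
      atTop atTop)
    (hmono : MonotoneOn (fun x : ℝ => -Real.log (g x) / Real.log x) (Ici a)) {y : ℕ → ℝ}
    (hy : ∀ k, a ≤ y k) {K : ℝ}
    (hyK : ∀ k : ℕ, -Real.log (g (y k ^ 2)) / Real.log (y k ^ 2) = K + k + 2) :
    ¬ Summable fun k => (y (k + 1))⁻¹ := by
  intro hs
  have hy0 : ∀ k, 0 < y k := fun k => by linarith [hy k]
  -- The ratio is only nondecreasing, so points are ordered by strict comparison of their values.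
  have hlt : ∀ (b : ℝ) (k : ℕ), a ≤ b → -Real.log (g (b ^ 2)) / Real.log (b ^ 2) < K + k + 2 → b ≤ y k := by
    intro b k hb h
    by_contra! hlt
    have := hmono (a := y k ^ 2) (b := b ^ 2) (by rw [mem_Ici]; nlinarith [hy k])
      (by rw [mem_Ici]; nlinarith) (pow_le_pow_left₀ (hy0 k).le hlt.le 2)
    simp only at this
    rw [hyK] at this
    linarith
  have hstep : ∀ k, y k ≤ y (k + 1) := fun k => hlt _ _ (hy k) (by rw [hyK]; push_cast; linarith)
  have htop : Tendsto y atTop atTop := by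
    refine tendsto_atTop.2 fun B => ?_
    obtain ⟨N, hN⟩ := exists_nat_gt
      (-Real.log (g (max a B ^ 2)) / Real.log (max a B ^ 2) - K - 2)
    filter_upwards [eventually_ge_atTop N] with k hk
    have hk' : (N : ℝ) ≤ k := by exact_mod_cast hk
    exact (le_max_right a B).trans (hlt _ k (le_max_left _ _) (by linarith))
  set φ : ℝ → ℝ := fun x => -Real.log (g (x ^ 2)) / (x ^ 2 * Real.log x) with hφ
  -- Summation by parts of `∑ (K + k + 3) * (1 / y k - 1 / y (k + 1))`; the boundary term at `N` is
  -- eventually nonpositive and is dropped.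
  have hbound : ∀ N : ℕ, ∫ x in a..y N, φ x ≤ (∫ x in a..y 0, φ x) +
      2 * ((K + 3) * (y 0)⁻¹ + ∑ k ∈ Finset.range N, (y (k + 1))⁻¹ - (K + N + 3) * (y N)⁻¹) := by
    intro N
    induction N with
    | zero => simp
    | succ N ih =>
      have h1 := (integral_log_density_le ha hcont hpos hmono le_rfl (hy N) (hyK N).le).1
      have h2 := integral_log_density_le ha hcont hpos hmono (hy N) (hstep N) (hyK (N + 1)).le
      rw [← intervalIntegral.integral_add_adjacent_intervals h1 h2.1, Finset.sum_range_succ]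
      have h3 := h2.2
      push_cast at h3 ⊢
      linarith
  have hyN : ∀ᶠ N : ℕ in atTop, 0 ≤ K + N + 3 := by
    obtain ⟨N, hN⟩ := exists_nat_ge (-K - 3)
    filter_upwards [eventually_ge_atTop N] with k hk
    have hk' : (N : ℝ) ≤ k := by exact_mod_cast hk
    linarith
  obtain ⟨N, hN, hN'⟩ := (((hK.comp htop).eventually_gt_atTop ((∫ x in a..y 0, φ x) +
    2 * ((K + 3) * (y 0)⁻¹ + ∑' k, (y (k + 1))⁻¹))).and hyN).exists
  have h1 := hs.sum_le_tsum (Finset.range N) fun k _ => (inv_pos.2 (hy0 (k + 1))).le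
  have h2 := mul_nonneg hN' (inv_pos.2 (hy0 N)).le
  have h3 := hbound N
  simp only [Function.comp_apply] at hN
  linarith

/-- The solutions of `-log g x / log x = K + k + 2` beyond `a ^ 2`, in terms of square roots. -/
lemma exists_level_points (ha : 1 < a) (hcont : ContinuousOn g (Ici a))
    (hpos : ∀ x ∈ Ici a, 0 < g x)
    (hlim : Tendsto (fun x : ℝ => -Real.log (g x) / Real.log x) atTop atTop) :
    ∃ (K : ℕ) (y : ℕ → ℝ), (∀ k, a ≤ y k) ∧
      ∀ k : ℕ, -Real.log (g (y k ^ 2)) / Real.log (y k ^ 2) = K + k + 2 := by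
  -- `K` dominates the value at the left endpoint `a ^ 2`, so the intermediate value theorem reaches
  -- every level `K + k + 2`.
  obtain ⟨K, hK⟩ := exists_nat_ge (-Real.log (g (a ^ 2)) / Real.log (a ^ 2))
  have hsq : a ≤ a ^ 2 := by nlinarith
  have : ∀ k : ℕ, ∃ y, a ≤ y ∧ -Real.log (g (y ^ 2)) / Real.log (y ^ 2) = K + k + 2 := by
    intro k
    obtain ⟨B, hB, haB⟩ :=
      ((hlim.eventually_ge_atTop ((K : ℝ) + k + 2)).and (eventually_ge_atTop (a ^ 2))).exists
    have hc : ContinuousOn (fun x : ℝ => -Real.log (g x) / Real.log x) (Icc (a ^ 2) B) := by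
      refine (((hcont.mono fun x hx => hsq.trans hx.1).log fun x hx =>
        (hpos x (hsq.trans hx.1)).ne').neg).div
        (Real.continuousOn_log.mono fun x hx => ?_) fun x hx => ?_
      · have := hx.1
        simp only [mem_compl_iff, mem_singleton_iff]
        linarith
      · exact (Real.log_pos (by linarith [hx.1])).ne'
    have hk : (0 : ℝ) ≤ k := k.cast_nonneg
    obtain ⟨x, hx, hxk⟩ := intermediate_value_Icc haB hc ⟨by linarith, hB⟩
    have hx0 : 0 ≤ x := by linarith [hx.1]
    refine ⟨√x, Real.le_sqrt_of_sq_le hx.1, ?_⟩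
    rw [Real.sq_sqrt hx0]
    exact hxk
  choose y hy hyK using this
  exact ⟨K, y, hy, hyK⟩

/-- Carleman's condition for a distribution with a density satisfying the logarithmic
condition. -/
theorem HasDensityFrom.carlemanStieltjes [IsProbabilityMeasure G] (hneg : G (Iio 0) = 0)
    (hdens : HasDensityFrom G a g) (ha : 1 < a)
    (hcont : ContinuousOn g (Ici a)) (hpos : ∀ x ∈ Ici a, 0 < g x)
    (hK : Tendsto (fun R : ℝ => ∫ x in a..R, -Real.log (g (x ^ 2)) / (x ^ 2 * Real.log x))
      atTop atTop)
    (hmono : MonotoneOn (fun x : ℝ => -Real.log (g x) / Real.log x) (Ici a))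
    (hlim : Tendsto (fun x : ℝ => -Real.log (g x) / Real.log x) atTop atTop) :
    CarlemanStieltjes G := by
  have hmom := hdens.hasFiniteMoments hneg ha hcont hpos hmono hlim
  refine ⟨hmom, ?_⟩
  have hmpos : ∀ k : ℕ, 0 < ∫ x, x ^ k ∂G := by
    intro k
    rw [integral_pos_iff_support_of_nonneg_ae
      ((ae_nonneg_of_measure_Iio hneg).mono fun x hx => pow_nonneg hx k) (hmom k)]
    refine (pos_iff_ne_zero.2 (hdens.measure_Ioi_ne_zero hcont hpos)).trans_le
      (measure_mono fun x hx => ?_)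
    exact (pow_pos (by linarith [mem_Ioi.1 hx]) k).ne'
  obtain ⟨K, y, hy, hyK⟩ := exists_level_points ha hcont hpos hlim
  have hdiv := not_summable_inv_of_log_density ha hcont hpos hK hmono hy hyK
  by_contra hne
  have hs := ENNReal.summable_toReal hne
  rw [← summable_nat_add_iff K] at hs
  refine hdiv ((hs.mul_left 2).of_nonneg_of_le (fun k => ?_) fun k => ?_)
  · exact inv_nonneg.2 (by linarith [hy (k + 1)])
  · have hy1 : 1 ≤ y (k + 1) := by linarith [hy (k + 1)]
    -- The level at `y (k + 1)` is `(k + K + 1) + 2`, which admits the moment of order `k + K + 1`,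
    -- the one in the Carleman term of index `k + K`.
    have hm := (hdens.moment_le hneg ha hcont hpos hmono (b := y (k + 1) ^ 2) (k := k + K + 1)
      (by nlinarith [hy (k + 1)]) (by rw [hyK]; push_cast; linarith)).2
    have hp := hmpos (k + K + 1)
    set m := ∫ x, x ^ (k + K + 1) ∂G
    set y' := y (k + 1)
    rw [ENNReal.ofReal_rpow_of_pos hp, ENNReal.toReal_ofReal (Real.rpow_nonneg hp.le _), neg_div,
      Real.rpow_neg hp.le]
    -- The constant in `m ≤ 2 * (y' ^ 2) ^ (k + K + 1)` is absorbed by `4 ^ (k + K + 1)`, at the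
    -- price of the factor `2` before `y'`.
    have hroot : m ^ (1 / (2 * (((k + K : ℕ) : ℝ) + 1))) ≤ 2 * y' := by
      rw [one_div, Real.rpow_inv_le_iff_of_pos hp.le (by linarith) (by positivity)]
      have he : (2 * y') ^ (2 * (((k + K : ℕ) : ℝ) + 1)) =
          4 ^ (k + K + 1) * (y' ^ 2) ^ (k + K + 1) := by
        rw [show (2 * (((k + K : ℕ) : ℝ) + 1)) = ((2 * (k + K + 1) : ℕ) : ℝ) by push_cast; ring,
          Real.rpow_natCast, pow_mul, ← mul_pow]
        congr 1
        ring
      rw [he]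
      refine hm.trans (mul_le_mul_of_nonneg_right ?_ (by positivity))
      calc (2 : ℝ) ≤ 4 ^ 1 := by norm_num
        _ ≤ 4 ^ (k + K + 1) := pow_le_pow_right₀ (by norm_num) (by omega)
    have hrp := Real.rpow_pos_of_pos hp (1 / (2 * (((k + K : ℕ) : ℝ) + 1)))
    have := inv_anti₀ hrp hroot
    rw [mul_inv] at this
    linarith

end Density

theorem mainTheorem6 {Ω : Type*} [MeasurableSpace Ω] (P : Measure Ω) [IsProbabilityMeasure P]
    (Y : Ω → ℝ) (G : Measure ℝ) (hYG : HasLaw Y G P) (hY : ∀ᵐ ω ∂P, 0 ≤ Y ω)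
    (a : ℝ) (ha : 1 < a) (g : ℝ → ℝ)
    (hdens : HasDensityFrom G a g)
    (hcont : ContinuousOn g (Ici a)) (hpos : ∀ x ∈ Ici a, 0 < g x)
    (hK : Tendsto (fun R : ℝ => ∫ x in a..R, -Real.log (g (x ^ 2)) / (x ^ 2 * Real.log x))
      atTop atTop)
    (hmono : MonotoneOn (fun x : ℝ => -Real.log (g x) / Real.log x) (Ici a))
    (hlim : Tendsto (fun x : ℝ => -Real.log (g x) / Real.log x) atTop atTop) :
    CarlemanStieltjes G ∧ MDeterminateStieltjes G := by
  have : IsProbabilityMeasure G := by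
    rw [← hYG.map_eq]
    exact Measure.isProbabilityMeasure_map hYG.aemeasurable
  have hneg : G (Iio 0) = 0 := by
    rw [← hYG.map_eq, Measure.map_apply_of_aemeasurable hYG.aemeasurable measurableSet_Iio]
    rw [ae_iff] at hY
    simp only [not_le] at hY
    exact hY
  have hC := hdens.carlemanStieltjes hneg ha hcont hpos hK hmono hlim
  refine ⟨hC, hC.mDeterminateStieltjes hneg fun h0 => ?_⟩
  exact hdens.measure_Ioi_ne_zero hcont hpos
    (measure_mono_null (Ioi_subset_Ioi (by linarith)) h0)
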